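/- **Setting.** Let $Z$ be a real Banach manifold with an involutive diffeomorphism $z\mapsto z^{-*}$, and let $\Pi\colon D\to Z$ be a smooth vector bundle whose typical fibre is a complex Banach space $\mathcal F$. A *like-Hermitian structure* on $\Pi$ is a family of maps $(\cdot\mid\cdot)_{z,z^{-*}}\colon D_z\times D_{z^{-*}}\to\mathbb C$ ($z\in Z$) such that: (a) each of them is a sesquilinear strong duality pairing, i.e. it is continuous, linear in the first and antilinear in the second variable, and $\xi\mapsto(\xi\mid\cdot)_{z,z^{-*}}$ and $\eta\mapsto(\cdot\mid\eta)_{z,z^{-*}}$ are topological isomorphisms onto the spaces of continuous antilinear functionals on $D_{z^{-*}}$ and of continuous linear functionals on $D_z$ (the second one being antilinear); (b) $\overline{(\xi\mid\eta)}_{z,z^{-*}}=(\eta\mid\xi)_{z^{-*},z}$; (c) in local trivializations of $\Pi$ the pairing depends smoothly on $z$ and on the two vectors. Assume that $\Pi$ is like-Hermitian, i.e. endowed with such a structure. A *reproducing $(-*)$-kernel* on $\Pi$ is a family $K$ of bounded operators $K(s,t)\colon D_t\to D_s$ ($s,t\in Z$) with $\sum_{j,l=1}^n\bigl(K(t_l,t_j^{-*})\eta_j\mid\eta_l\bigr)_{t_l,t_l^{-*}}\ge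 0$ for all $n\ge1$, $t_j\in Z$, $\eta_j\in D_{t_j^{-*}}$. For $\xi\in D_s$ let $K_\xi:=K(\cdot,s)\xi$, a section of $\Pi$. The Hilbert space $\mathcal H^K$ is the completion of $\operatorname{span}\{K_\xi\mid\xi\in D\}$ with respect to the scalar product determined by $(K_\eta\mid K_\xi)_{\mathcal H^K}=(K(s^{-*},t)\eta\mid\xi)_{s^{-*},s}$ for $\xi\in D_s$, $\eta\in D_t$. Put $\widehat K\colon D\to\mathcal H^K$, $\widehat K(\xi)=K_\xi$. For a complex Hilbert space $\mathcal H$ let $\mathrm{Gr}(\mathcal H)$ be the Grassmann manifold of all closed linear subspaces of $\mathcal H$, let $\Pi_{\mathcal H}\colon\mathcal T(\mathcal H)=\{(\mathcal S,x)\mid x\in\mathcal S\in\mathrm{Gr}(\mathcal H)\}\to\mathrm{Gr}(\mathcal H)$ be the tautological bundle, and let $p_{\mathcal S}\colon\mathcal H\to\mathcal S$ be the orthogonal projection. An *involutive morphism* $\Omega=(\gamma,\omega)$ on $\Pi_{\mathcal H}$ consists of an involutive diffeomorphism $\omega$ of $\mathrm{Gr}(\mathcal H)$, written $\mathcal S\mapsto\mathcal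 S^{-*}$, and a smooth map $\gamma\colon\mathcal T(\mathcal H)\to\mathcal T(\mathcal H)$ over $\omega$ such that every $\gamma_{\mathcal S}\colon\mathcal S\to\mathcal S^{-*}$ is a linear isometric bijection, $\gamma_{\mathcal S^{-*}}=(\gamma_{\mathcal S})^{-1}$, and $(\gamma_{\mathcal S_1}x_1\mid\gamma_{\mathcal S_2}x_2)_{\mathcal H}=(x_1\mid x_2)_{\mathcal H}$ for all $x_1\in\mathcal S_1$, $x_2\in\mathcal S_2$. Let $\Pi_{\mathcal H,\Omega}$ be $\Pi_{\mathcal H}$ with the involution $\omega$ of the base and the like-Hermitian structure $(x\mid y)_{\mathcal S,\mathcal S^{-*}}=(x\mid\gamma_{\mathcal S^{-*}}y)_{\mathcal H}$, and let $Q_{\mathcal H,\Omega}(\mathcal S_1,\mathcal S_2)=p_{\mathcal S_1}\circ\gamma_{\mathcal S_2}\colon\mathcal S_2\to\mathcal S_1$, a reproducing $(-*)$-kernel on $\Pi_{\mathcal H,\Omega}$. A *vector bundle morphism* $\Delta=(\delta,\zeta)$ from $\Pi\colon D\to Z$ into a like-Hermitian bundle $\Pi'\colon D'\to Z'$ is here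 understood in the algebraic sense: maps $\zeta\colon Z\to Z'$ and $\delta\colon D\to D'$ with $\Pi'\circ\delta=\zeta\circ\Pi$, such that $\zeta(z^{-*})=\zeta(z)^{-*}$ and $\delta_z:=\delta|_{D_z}\colon D_z\to D'_{\zeta(z)}$ is bounded and linear for every $z\in Z$ (no continuity or smoothness of $\zeta$ or of $\delta$ on $D$ is required). Let $(\delta_z)^{-*}\colon D'_{\zeta(z)^{-*}}\to D_{z^{-*}}$ be the bounded operator with $(\delta_z\xi\mid\eta)_{\zeta(z),\zeta(z)^{-*}}=(\xi\mid(\delta_z)^{-*}\eta)_{z,z^{-*}}$. The *pull-back* of a reproducing $(-*)$-kernel $Q$ on $\Pi'$ is $(\Delta^*Q)(s,t)=(\delta_{s^{-*}})^{-*}\circ Q(\zeta(s),\zeta(t))\circ\delta_t$. **Theorem.** Let $K$ be a reproducing $(-*)$-kernel on the like-Hermitian vector bundle $\Pi\colon D\to Z$, and define $\zeta_K\colon Z\to\mathrm{Gr}(\mathcal H^K)$, $\zeta_K(s):=\overline{\widehat K(D_s)}$. Let $\Omega=(\gamma,\omega)$ be an involutive morphism on $\Pi_{\mathcal H^K}$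 such that $\zeta_K(s^{-*})=\omega(\zeta_K(s))$ for all $s\in Z$. Then there exists a vector bundle morphism $\Delta_K=(\delta_K,\zeta_K)$, with second component the map $\zeta_K$, from $\Pi$ into $\Pi_{\mathcal H^K,\Omega}$ such that $K=(\Delta_K)^*Q_{\mathcal H^K,\Omega}$. -/

import Mathlib

open Bundle Filter Topology
open scoped Manifold ContDiff ComplexOrder ComplexConjugate InnerProductSpace

universe u v u' v'

noncomputable section

/-! ### Like-Hermitian structures -/

/-- A sesquilinear map `b : X × Y → ℂ` (linear in the first, antilinear in the second variable)
is a strong duality pairing: it is continuous, and `x ↦ b x ·` and `y ↦ b · y` are topological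
isomorphisms onto the space of continuous antilinear functionals on `Y`, respectively (antilinear)
onto the space of continuous linear functionals on `X`. -/
structure IsStrongDualityPairing {X : Type u} {Y : Type v}
    [TopologicalSpace X] [AddCommGroup X] [Module ℂ X]
    [TopologicalSpace Y] [AddCommGroup Y] [Module ℂ Y]
    (b : X →ₗ[ℂ] Y →ₗ⋆[ℂ] ℂ) : Prop where
  continuous : Continuous fun p : X × Y => b p.1 p.2
  exists_left : ∃ e : X ≃L[ℂ] (Y →L⋆[ℂ] ℂ), ∀ x y, e x y = b x y
  exists_right : ∃ e : Y ≃L⋆[ℂ] (X →L[ℂ] ℂ), ∀ x y, e y x = b x y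

/-- The fibrewise (purely algebraic) part of a like-Hermitian structure on a family `D` of complex
topological vector spaces over a set `Z`: an involution `z ↦ z^{-*}` of the base, written `inv`,
and pairings `(· | ·)_{z, z^{-*}} : D_z × D_{z^{-*}} → ℂ`. In order to avoid transports between
fibres over equal points, the pairing is indexed by two points `z`, `w` with a proof of
`w = z^{-*}`. -/
structure FibrewiseLikeHermitian (Z : Type u) (D : Z → Type v)
    [∀ z, TopologicalSpace (D z)] [∀ z, AddCommGroup (D z)] [∀ z, Module ℂ (D z)] where
  inv : Z → Z
  inv_inv : ∀ z, inv (inv z) = z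
  form : ∀ z w : Z, inv z = w → D z →ₗ[ℂ] D w →ₗ⋆[ℂ] ℂ
  strong : ∀ (z w : Z) (h : inv z = w), IsStrongDualityPairing (form z w h)
  conj_form : ∀ (z w : Z) (h : inv z = w) (h' : inv w = z) (ξ : D z) (η : D w),
    conj (form z w h ξ η) = form w z h' η ξ

/-- A like-Hermitian structure on a smooth vector bundle `D → Z` whose base is a real Banach
manifold `Z` (modelled on `E`) and whose typical fibre is a complex Banach space `F`: besides the
fibrewise part, the involution of the base is smooth (hence an involutive diffeomorphism) and the
pairing is smooth in local trivializations. -/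
structure LikeHermitianStructure {Z : Type u} (E : Type*) (F : Type*) (D : Z → Type v)
    [NormedAddCommGroup E] [NormedSpace ℝ E]
    [NormedAddCommGroup F] [NormedSpace ℂ F]
    [TopologicalSpace Z] [ChartedSpace E Z]
    [TopologicalSpace (TotalSpace F D)]
    [∀ z, TopologicalSpace (D z)] [∀ z, AddCommGroup (D z)] [∀ z, Module ℂ (D z)]
    [FiberBundle F D] [VectorBundle ℂ F D] extends FibrewiseLikeHermitian Z D where
  contMDiff_inv : ContMDiff 𝓘(ℝ, E) 𝓘(ℝ, E) ∞ inv
  contMDiffOn_form : ∀ (e e' : Trivialization F (π F D))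
    [MemTrivializationAtlas e] [MemTrivializationAtlas e'],
    ContMDiffOn (𝓘(ℝ, E).prod (𝓘(ℝ, F).prod 𝓘(ℝ, F))) 𝓘(ℝ, ℂ) ∞
      (fun p : Z × F × F =>
        form p.1 (inv p.1) rfl (e.symm p.1 p.2.1) (e'.symm (inv p.1) p.2.2))
      {p | p.1 ∈ e.baseSet ∧ inv p.1 ∈ e'.baseSet}

/-! ### Reproducing `(-*)`-kernels -/

section Algebraic

variable {Z : Type u} {D : Z → Type v}
  [∀ z, TopologicalSpace (D z)] [∀ z, AddCommGroup (D z)] [∀ z, Module ℂ (D z)]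
  {Z' : Type u'} {D' : Z' → Type v'}
  [∀ z, TopologicalSpace (D' z)] [∀ z, AddCommGroup (D' z)] [∀ z, Module ℂ (D' z)]

/-- A reproducing `(-*)`-kernel: a family of bounded operators `K(s,t) : D_t → D_s` such that
`∑_{j,l} (K(t_l, t_j^{-*}) η_j | η_l)_{t_l, t_l^{-*}} ≥ 0` for all `t_j ∈ Z`,
`η_j ∈ D_{t_j^{-*}}`. (Here `t' j` is `t_j^{-*}`; `0 ≤ c` for `c : ℂ` means that `c` is real and
nonnegative.) -/
@[ext]
structure ReproducingKernel (L : FibrewiseLikeHermitian Z D) where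
  toFun : ∀ s t : Z, D t →L[ℂ] D s
  pos : ∀ (n : ℕ) (t t' : Fin n → Z) (h : ∀ j, L.inv (t j) = t' j) (η : ∀ j, D (t' j)),
    0 ≤ ∑ j, ∑ l, L.form (t l) (t' l) (h l) (toFun (t l) (t' j) (η j)) (η l)

namespace ReproducingKernel

variable {L : FibrewiseLikeHermitian Z D} (K : ReproducingKernel L)

/-- The section `K_ξ = K(·, s) ξ` of `D → Z`, for `ξ ∈ D_s`. -/
def kerSection (s : Z) : D s →ₗ[ℂ] (∀ z, D z) where
  toFun ξ := fun z => K.toFun z s ξ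
  map_add' ξ η := by ext z; simp
  map_smul' c ξ := by ext z; simp

/-- The space `H₀^K`, spanned by the sections `K_ξ`, `ξ ∈ D`. -/
def preSubmodule : Submodule ℂ (∀ z, D z) :=
  Submodule.span ℂ (Set.range fun p : Σ z, D z => K.kerSection p.1 p.2)

/-- `H₀^K` as a type of its own. -/
def PreRKHS : Type (max u v) := K.preSubmodule

instance : AddCommGroup K.PreRKHS := inferInstanceAs (AddCommGroup K.preSubmodule)
instance : Module ℂ K.PreRKHS := inferInstanceAs (Module ℂ K.preSubmodule)

/-- `K_ξ` as an element of `H₀^K`. -/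
def preHat (s : Z) : D s →ₗ[ℂ] K.PreRKHS :=
  (K.kerSection s).codRestrict K.preSubmodule fun ξ => Submodule.subset_span ⟨⟨s, ξ⟩, rfl⟩

/-- For a formal combination `f = ∑ c_i ξ_i` with `ξ_i ∈ D_{s_i}` and a section `G`, the number
`∑ conj(c_i) (G(s_i^{-*}) | ξ_i)_{s_i^{-*}, s_i}`. -/
def pairSection (f : (Σ z, D z) →₀ ℂ) (G : ∀ z, D z) : ℂ :=
  f.sum fun p c => conj c * L.form (L.inv p.1) p.1 (L.inv_inv p.1) (G (L.inv p.1)) p.2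

/-- A representation of an element of `H₀^K` as a linear combination of sections `K_ξ`. -/
def rep (G : K.PreRKHS) : (Σ z, D z) →₀ ℂ :=
  (Finsupp.mem_span_range_iff_exists_finsupp.1 G.2).choose

/-- The scalar product of `H₀^K`; in Mathlib's convention `⟪x, y⟫` is antilinear in the first
variable. It is determined by `⟪K_ξ, K_η⟫ = (K(s^{-*}, t) η | ξ)_{s^{-*}, s}` for `ξ ∈ D_s`,
`η ∈ D_t`, see `inner_preHat` below. -/
def preInner (F G : K.PreRKHS) : ℂ := pairSection (L := L) (K.rep F) G.1

theorem rep_spec (G : K.PreRKHS) :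
    ((K.rep G).sum fun p c => c • K.kerSection p.1 p.2) = G.1 :=
  (Finsupp.mem_span_range_iff_exists_finsupp.1 G.2).choose_spec

theorem pos_fintype {ι : Type*} [Fintype ι] (s : ι → Z) (ξ : ∀ i, D (s i)) :
    0 ≤ ∑ j, ∑ l, L.form (L.inv (s l)) (s l) (L.inv_inv _)
      (K.toFun (L.inv (s l)) (s j) (ξ j)) (ξ l) := by
  have e := Fintype.equivFin ι
  have := K.pos _ (fun j => L.inv (s (e.symm j))) (fun j => s (e.symm j))
    (fun j => L.inv_inv _) (fun j => ξ (e.symm j))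
  refine this.trans_eq ?_
  rw [← e.symm.sum_comp]
  refine Finset.sum_congr rfl fun j _ => ?_
  rw [← e.symm.sum_comp]

theorem form_symm (s t : Z) (ξ : D s) (η : D t) :
    L.form (L.inv s) s (L.inv_inv _) (K.toFun (L.inv s) t η) ξ =
      conj (L.form (L.inv t) t (L.inv_inv _) (K.toFun (L.inv t) s ξ) η) := by
  have h0 : ∀ (r : Z) (x : D r),
      (L.form (L.inv r) r (L.inv_inv _) (K.toFun (L.inv r) r x) x).im = 0 := by
    intro r x
    have := K.pos_fintype (fun _ : Unit => r) (fun _ => x)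
    simp only [Finset.univ_unique, Finset.sum_singleton] at this
    exact (Complex.le_def.1 this).2.symm
  have h1 : ∀ x : D s,
      (L.form (L.inv s) s (L.inv_inv _) (K.toFun (L.inv s) t η) x).im +
        (L.form (L.inv t) t (L.inv_inv _) (K.toFun (L.inv t) s x) η).im = 0 := by
    intro x
    have := K.pos_fintype (fun b : Bool => cond b s t)
      (fun b => match b with | true => x | false => η)
    have h := (Complex.le_def.1 this).2
    simp only [Fintype.sum_bool, cond_true, cond_false, Complex.add_im, Complex.zero_im] at h
    have hs := h0 s x
    have ht := h0 t η
    linarith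
  have hA := h1 ξ
  have hB := h1 (Complex.I • ξ)
  simp only [map_smulₛₗ, LinearMap.smul_apply, smul_eq_mul, Complex.conj_I, RingHom.id_apply,
    Complex.mul_im, Complex.I_re, Complex.I_im, Complex.neg_re, Complex.neg_im] at hB
  apply Complex.ext
  · simp only [Complex.conj_re]; linarith
  · simp only [Complex.conj_im]; linarith

theorem pairSection_single (s : Z) (ξ : D s) (G : ∀ z, D z) :
    pairSection (L := L) (Finsupp.single ⟨s, ξ⟩ 1) G =
      L.form (L.inv s) s (L.inv_inv _) (G (L.inv s)) ξ := by
  simp [pairSection]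

theorem pairSection_symm (f g : (Σ z, D z) →₀ ℂ) :
    pairSection (L := L) f (g.sum fun p c => c • K.kerSection p.1 p.2) =
      conj (pairSection (L := L) g (f.sum fun p c => c • K.kerSection p.1 p.2)) := by
  simp only [pairSection, Finsupp.sum, Finset.sum_apply, Pi.smul_apply, map_sum, map_smul,
    LinearMap.sum_apply, LinearMap.smul_apply, smul_eq_mul, map_mul, Complex.conj_conj,
    Finset.mul_sum]
  rw [Finset.sum_comm]
  refine Finset.sum_congr rfl fun q _ => Finset.sum_congr rfl fun p _ => ?_
  have := K.form_symm p.1 q.1 p.2 q.2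
  simp only [kerSection, LinearMap.coe_mk, AddHom.coe_mk]
  rw [this]
  ring

theorem preInner_symm (F G : K.PreRKHS) : conj (K.preInner G F) = K.preInner F G := by
  unfold preInner
  conv_rhs => rw [← K.rep_spec G, K.pairSection_symm, K.rep_spec]

theorem preInner_add_right (F G H : K.PreRKHS) :
    K.preInner F (G + H) = K.preInner F G + K.preInner F H := by
  have : (G + H).1 = G.1 + H.1 := rfl
  simp [preInner, pairSection, this, mul_add, Finsupp.sum_add]

theorem preInner_smul_right (F G : K.PreRKHS) (c : ℂ) :
    K.preInner F (c • G) = c * K.preInner F G := by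
  have : (c • G).1 = c • G.1 := rfl
  simp only [preInner, pairSection, this, Pi.smul_apply, map_smul, LinearMap.smul_apply,
    smul_eq_mul, Finsupp.sum, Finset.mul_sum]
  exact Finset.sum_congr rfl fun p _ => by ring

theorem preInner_preHat (s : Z) (ξ : D s) (G : K.PreRKHS) :
    K.preInner (K.preHat s ξ) G = L.form (L.inv s) s (L.inv_inv _) (G.1 (L.inv s)) ξ := by
  rw [← pairSection_single, ← K.preInner_symm, preInner, ← K.rep_spec G, K.pairSection_symm]
  simp only [Finsupp.sum_single_index, zero_smul, one_smul]
  rfl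

theorem preInner_self_nonneg (F : K.PreRKHS) : 0 ≤ K.preInner F F := by
  have := K.pos_fintype (fun p : (K.rep F).support => p.1.1) (fun p => K.rep F p.1 • p.1.2)
  refine this.trans_eq ?_
  unfold preInner
  conv_rhs => rw [← K.rep_spec F]
  simp only [pairSection, Finsupp.sum, Finset.sum_apply, Pi.smul_apply, map_sum, map_smul,
    LinearMap.sum_apply, LinearMap.smul_apply, smul_eq_mul, map_smulₛₗ, Finset.mul_sum,
    kerSection, LinearMap.coe_mk, AddHom.coe_mk]
  rw [Finset.sum_comm]
  rw [← Finset.sum_coe_sort (K.rep F).support]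
  refine Finset.sum_congr rfl fun p _ => ?_
  rw [← Finset.sum_coe_sort (K.rep F).support]

theorem form_left_injective {z w : Z} (h : L.inv z = w) {ξ : D z}
    (hξ : ∀ η, L.form z w h ξ η = 0) : ξ = 0 := by
  obtain ⟨e, he⟩ := (L.strong z w h).exists_left
  apply e.injective
  ext η
  rw [he, hξ]
  simp

/-- The scalar product of `H₀^K` without its definiteness. -/
@[reducible]
def preCore₀ : PreInnerProductSpace.Core ℂ K.PreRKHS where
  inner := K.preInner
  conj_inner_symm := K.preInner_symm
  re_inner_nonneg F := (Complex.le_def.1 (K.preInner_self_nonneg F)).1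
  add_left F G H := by
    change K.preInner _ _ = K.preInner _ _ + K.preInner _ _
    rw [← K.preInner_symm, preInner_add_right, map_add, K.preInner_symm, K.preInner_symm]
  smul_left F G c := by
    change K.preInner _ _ = _ * K.preInner _ _
    rw [← K.preInner_symm, preInner_smul_right, map_mul, K.preInner_symm]

/-- The scalar product of `H₀^K`. -/
@[reducible]
def preCore : InnerProductSpace.Core ℂ K.PreRKHS where
  toCore := K.preCore₀
  definite F hF := by
    let := K.preCore₀
    have key : ∀ G : K.PreRKHS, K.preInner G F = 0 := by
      intro G
      have h := InnerProductSpace.Core.inner_mul_inner_self_le (𝕜 := ℂ) G F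
      have h' : ‖K.preInner G F‖ * ‖K.preInner F G‖ ≤
          RCLike.re (K.preInner G G) * RCLike.re (K.preInner F F) := h
      have hF' : K.preInner F F = 0 := hF
      rw [hF', ← K.preInner_symm F G, RCLike.norm_conj] at h'
      simp only [map_zero, mul_zero] at h'
      have : ‖K.preInner G F‖ = 0 := by nlinarith [norm_nonneg (K.preInner G F)]
      exact norm_eq_zero.1 this
    apply Subtype.ext
    funext z
    refine form_left_injective (L := L) (z := z) (w := L.inv z) rfl fun η => ?_
    have := key (K.preHat (L.inv z) η)
    rw [preInner_preHat] at this
    have hz := L.inv_inv z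
    have aux : ∀ (y : Z) (hy : L.inv (L.inv z) = y) (h2 : L.inv y = L.inv z),
        L.form y (L.inv z) h2 (F.1 y) η = 0 := by
      intro y hy h2
      subst hy
      exact this
    exact aux z hz rfl

instance : NormedAddCommGroup K.PreRKHS :=
  K.preCore.toNormedAddCommGroup

instance : InnerProductSpace ℂ K.PreRKHS :=
  InnerProductSpace.ofCore K.preCore.toCore

/-- The reproducing kernel Hilbert space `H^K`, the completion of `H₀^K`. -/
abbrev RKHS : Type (max u v) := UniformSpace.Completion K.PreRKHS

/-- The map `K̂ : D → H^K`, `K̂(ξ) = K_ξ`, on the fibre `D_s`. -/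
def hat (s : Z) : D s →ₗ[ℂ] K.RKHS :=
  (UniformSpace.Completion.toComplL (𝕜 := ℂ) (E := K.PreRKHS)).toLinearMap ∘ₗ K.preHat s

/-- The scalar product of `H^K` is the one determined by
`(K_η | K_ξ) = (K(s^{-*}, t) η | ξ)_{s^{-*}, s}`. -/
theorem inner_hat (s t : Z) (ξ : D s) (η : D t) :
    ⟪K.hat s ξ, K.hat t η⟫_ℂ =
      L.form (L.inv s) s (L.inv_inv _) (K.toFun (L.inv s) t η) ξ := by
  refine (UniformSpace.Completion.inner_coe (K.preHat s ξ) (K.preHat t η)).trans ?_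
  exact K.preInner_preHat s ξ (K.preHat t η)

/-- The map `ζ_K : Z → Gr(H^K)`, `ζ_K(s)` being the closure of `K̂(D_s)`. -/
def zeta (s : Z) : ClosedSubmodule ℂ K.RKHS := (LinearMap.range (K.hat s)).closure

end ReproducingKernel

/-! ### Bundle morphisms and pull-backs of kernels -/

/-- An (algebraic) vector bundle morphism `Θ = (δ, ζ)` between families of vector spaces with
fibrewise like-Hermitian structures: a map `ζ` of the bases compatible with the involutions, and
bounded linear operators `δ_z : D_z → D'_{ζ(z)}`. -/
structure LikeHermitianMorphism (L : FibrewiseLikeHermitian Z D)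
    (L' : FibrewiseLikeHermitian Z' D') where
  base : Z → Z'
  fiber : ∀ z, D z →L[ℂ] D' (base z)
  base_inv : ∀ z, base (L.inv z) = L'.inv (base z)

namespace FibrewiseLikeHermitian

variable (L : FibrewiseLikeHermitian Z D)

/-- The antilinear isomorphism `η ↦ (· | η)_{z, w}` of `D_w` onto the dual of `D_z`, for
`w = z^{-*}`. -/
def rightDual {z w : Z} (h : L.inv z = w) : D w ≃L⋆[ℂ] (D z →L[ℂ] ℂ) :=
  (L.strong z w h).exists_right.choose

theorem rightDual_apply {z w : Z} (h : L.inv z = w) (ξ : D z) (η : D w) :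
    L.rightDual h η ξ = L.form z w h ξ η :=
  (L.strong z w h).exists_right.choose_spec ξ η

end FibrewiseLikeHermitian

namespace LikeHermitianMorphism

variable {L : FibrewiseLikeHermitian Z D} {L' : FibrewiseLikeHermitian Z' D'}
  (Θ : LikeHermitianMorphism L L')

/-- The quasi-adjoint `(δ_z)^{-*} : D'_{ζ(z)^{-*}} → D_{z^{-*}}`, with `w = z^{-*}` and
`y = ζ(z)^{-*}`; it is characterized by `form_quasiAdjoint`. -/
def quasiAdjoint {z w : Z} {y : Z'} (h : L.inv z = w) (h' : L'.inv (Θ.base z) = y) :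
    D' y →L[ℂ] D w :=
  ((L.rightDual h).symm : (D z →L[ℂ] ℂ) →L⋆[ℂ] D w).comp
    ((ContinuousLinearMap.precomp ℂ (Θ.fiber z)).comp
      (L'.rightDual h' : D' y →L⋆[ℂ] (D' (Θ.base z) →L[ℂ] ℂ)))

theorem form_quasiAdjoint {z w : Z} {y : Z'} (h : L.inv z = w) (h' : L'.inv (Θ.base z) = y)
    (ξ : D z) (η : D' y) :
    L'.form (Θ.base z) y h' (Θ.fiber z ξ) η = L.form z w h ξ (Θ.quasiAdjoint h h' η) := by
  rw [← L.rightDual_apply, ← L'.rightDual_apply]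
  simp [quasiAdjoint]

theorem base_eq {s : Z} : L'.inv (Θ.base (L.inv s)) = Θ.base s := by
  rw [Θ.base_inv, L'.inv_inv]

theorem form_quasiAdjoint' {s w : Z} (h : L.inv s = w) (h' : L'.inv (Θ.base s) = Θ.base w)
    (x : D' (Θ.base s)) (ξ : D w) :
    L'.form (Θ.base s) (Θ.base w) h' x (Θ.fiber w ξ) =
      L.form s w h (Θ.quasiAdjoint (L.inv_inv s) Θ.base_eq x) ξ := by
  subst h
  rw [← L'.conj_form _ _ Θ.base_eq, Θ.form_quasiAdjoint (L.inv_inv s), L.conj_form]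

/-- The pull-back `Θ^* Q` of a reproducing `(-*)`-kernel `Q`, given by
`(Θ^* Q)(s, t) = (δ_{s^{-*}})^{-*} ∘ Q(ζ(s), ζ(t)) ∘ δ_t`. -/
def pullback (Q : ReproducingKernel L') : ReproducingKernel L where
  toFun s t := (Θ.quasiAdjoint (L.inv_inv s) Θ.base_eq).comp
    ((Q.toFun (Θ.base s) (Θ.base t)).comp (Θ.fiber t))
  pos n t t' h η := by
    have hpos := Q.pos n (fun j => Θ.base (t j)) (fun j => Θ.base (t' j))
      (fun j => by rw [← Θ.base_inv, h]) (fun j => Θ.fiber _ (η j))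
    refine hpos.trans_eq ?_
    refine Finset.sum_congr rfl fun j _ => Finset.sum_congr rfl fun l _ => ?_
    exact Θ.form_quasiAdjoint' (h l) _ _ _

end LikeHermitianMorphism

end Algebraic

/-! ### The tautological bundle over the Grassmannian -/

section Grassmannian

theorem exists_leftEquiv {X : Type u} {Y : Type v} [NormedAddCommGroup X] [NormedSpace ℂ X]
    [CompleteSpace X] [NormedAddCommGroup Y] [NormedSpace ℂ Y]
    (b : X →ₗ[ℂ] Y →ₗ⋆[ℂ] ℂ) (f : X →L[ℂ] (Y →L⋆[ℂ] ℂ)) (hf : ∀ x y, f x y = b x y)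
    (h0 : ∀ x, (∀ y, b x y = 0) → x = 0) (h1 : ∀ φ : Y →L⋆[ℂ] ℂ, ∃ x, ∀ y, b x y = φ y) :
    ∃ e : X ≃L[ℂ] (Y →L⋆[ℂ] ℂ), ∀ x y, e x y = b x y := by
  refine ⟨ContinuousLinearEquiv.ofBijective f ?_ ?_, hf⟩
  · refine LinearMap.ker_eq_bot'.2 fun x hx => h0 x fun y => ?_
    rw [← hf, show f x = 0 from hx]
    rfl
  · refine LinearMap.range_eq_top.2 fun φ => ?_
    obtain ⟨x, hx⟩ := h1 φ
    refine ⟨x, ?_⟩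
    ext y
    exact (hf x y).trans (hx y)


variable (H : Type u) [NormedAddCommGroup H] [InnerProductSpace ℂ H]

/-- The Grassmannian `Gr(H)` of all closed linear subspaces of `H`. -/
abbrev Gr : Type u := ClosedSubmodule ℂ H

/-- The fibre over `S` of the tautological bundle `T(H) → Gr(H)`: the space `S` itself. -/
abbrev TautFiber (S : Gr H) : Type u := S.toSubmodule

/-- The total space `T(H) = {(S, x) | x ∈ S}` of the tautological bundle. -/
abbrev Taut : Type u := Σ S : Gr H, TautFiber H S

variable {H} [CompleteSpace H]

instance Gr.instCompleteSpace (S : Gr H) : CompleteSpace (TautFiber H S) :=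
  S.isClosed'.completeSpace_coe

/-- The standard chart of `Gr(H)` centred at `S`, written as a parametrization: a bounded operator
`A : S → Sᗮ` is mapped to its graph `{x + A x | x ∈ S}`. This is a bijection of the Banach space of
such operators onto the set of the closed complements of `Sᗮ`, which is an open neighbourhood of
`S`, and these charts define the manifold structure of `Gr(H)`. -/
def Gr.chart (S : Gr H) (A : TautFiber H S →L[ℂ] S.toSubmoduleᗮ) : Gr H where
  toSubmodule := (S.toSubmoduleᗮ.orthogonalProjectionOnto -
    A.comp S.toSubmodule.orthogonalProjectionOnto : H →L[ℂ] S.toSubmoduleᗮ).ker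
  isClosed' := ContinuousLinearMap.isClosed_ker (S.toSubmoduleᗮ.orthogonalProjectionOnto -
    A.comp S.toSubmodule.orthogonalProjectionOnto)

theorem Gr.add_mem_chart (S : Gr H) (A : TautFiber H S →L[ℂ] S.toSubmoduleᗮ)
    (x : TautFiber H S) : (x + A x : H) ∈ (Gr.chart S A).toSubmodule := by
  have h1 : S.toSubmodule.orthogonalProjectionOnto (A x : H) = 0 :=
    Submodule.orthogonalProjectionOnto_apply_of_mem_orthogonal (A x).2
  have h2 : S.toSubmoduleᗮ.orthogonalProjectionOnto (x : H) = 0 :=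
    Submodule.orthogonalProjectionOnto_orthogonal_apply_eq_zero x.2
  simp [Gr.chart, h1, h2]

/-- The chart of `T(H)` over the chart of `Gr(H)` centred at `S`, written as a parametrization (and
given by the local trivialization of the tautological bundle over that chart): the pair `(A, x)`
is mapped to the point `x + A x` of the graph of `A`. -/
def Taut.chart (S : Gr H) (p : (TautFiber H S →L[ℂ] S.toSubmoduleᗮ) × TautFiber H S) : Taut H :=
  ⟨Gr.chart S p.1, ⟨p.2 + p.1 p.2, Gr.add_mem_chart S p.1 p.2⟩⟩

/-- Smoothness (over `ℝ`) of a self-map of `Gr(H)`: at every point `S` the map is given, in the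
charts centred at `S` and at its image, by a smooth map of Banach spaces. -/
def Gr.IsSmooth (f : Gr H → Gr H) : Prop :=
  ∀ S : Gr H, ∃ Φ : (TautFiber H S →L[ℂ] S.toSubmoduleᗮ) →
      (TautFiber H (f S) →L[ℂ] (f S).toSubmoduleᗮ),
    ContDiffAt ℝ ∞ Φ 0 ∧ Φ 0 = 0 ∧ ∀ᶠ A in 𝓝 0, f (Gr.chart S A) = Gr.chart (f S) (Φ A)

/-- Smoothness (over `ℝ`) of a self-map of `T(H)`, likewise. -/
def Taut.IsSmooth (f : Taut H → Taut H) : Prop :=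
  ∀ p : Taut H, ∃ Φ : (TautFiber H p.1 →L[ℂ] p.1.toSubmoduleᗮ) × TautFiber H p.1 →
      (TautFiber H (f p).1 →L[ℂ] (f p).1.toSubmoduleᗮ) × TautFiber H (f p).1,
    ContDiffAt ℝ ∞ Φ (0, p.2) ∧ Φ (0, p.2) = (0, (f p).2) ∧
      ∀ᶠ q in 𝓝 (0, p.2), f (Taut.chart p.1 q) = Taut.chart (f p).1 (Φ q)

variable (H) in
/-- An involutive morphism `Ω = (γ, ω)` on the tautological bundle `T(H) → Gr(H)`. -/
structure InvolutiveMorphism where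
  /-- The map `ω : Gr(H) → Gr(H)`, also written `S ↦ S^{-*}`. -/
  base : Gr H → Gr H
  /-- The bounded linear operators `γ_S : S → S^{-*}`. -/
  fiber : ∀ S : Gr H, TautFiber H S →L[ℂ] TautFiber H (base S)
  isSmooth_base : Gr.IsSmooth base
  isSmooth_total : Taut.IsSmooth fun p : Taut H => ⟨base p.1, fiber p.1 p.2⟩
  base_base : ∀ S, base (base S) = S
  isometry_fiber : ∀ S, Isometry (fiber S)
  bijective_fiber : ∀ S, Function.Bijective (fiber S)
  /-- `γ_{S^{-*}} = (γ_S)^{-1}`; the two sides are compared in `H`. -/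
  fiber_fiber : ∀ (S : Gr H) (x : TautFiber H S), (fiber (base S) (fiber S x) : H) = x
  inner_fiber : ∀ (S T : Gr H) (x : TautFiber H S) (y : TautFiber H T),
    ⟪(fiber S x : H), (fiber T y : H)⟫_ℂ = ⟪(x : H), (y : H)⟫_ℂ

namespace InvolutiveMorphism

variable (Ω : InvolutiveMorphism H)

/-- The like-Hermitian structure `(x | y)_{S, S^{-*}} = (x | γ_{S^{-*}} y)_H` on the tautological
bundle associated with `Ω`; here `T` is `S^{-*}`. -/
def tautForm (S T : Gr H) : TautFiber H S →ₗ[ℂ] TautFiber H T →ₗ⋆[ℂ] ℂ :=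
  LinearMap.mk₂'ₛₗ (RingHom.id ℂ) (starRingEnd ℂ) (fun x y => ⟪(Ω.fiber T y : H), (x : H)⟫_ℂ)
    (fun x x' y => by simp) (fun c x y => by simp)
    (fun x y y' => by simp) (fun c x y => by simp [mul_comm])

theorem tautForm_apply (S T : Gr H) (x : TautFiber H S) (y : TautFiber H T) :
    Ω.tautForm S T x y = ⟪(Ω.fiber T y : H), (x : H)⟫_ℂ := rfl

theorem norm_fiber (T : Gr H) (y : TautFiber H T) : ‖Ω.fiber T y‖ = ‖y‖ :=
  (Ω.isometry_fiber T).norm_map_of_map_zero (map_zero _) y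

/-- `γ_T` as an isometric isomorphism. -/
def fiberEquiv (T : Gr H) : TautFiber H T ≃ₗᵢ[ℂ] TautFiber H (Ω.base T) :=
  { LinearEquiv.ofBijective (Ω.fiber T).toLinearMap (Ω.bijective_fiber T) with
    norm_map' := Ω.norm_fiber T }

theorem strong_tautForm (S T : Gr H) (h : Ω.base T = S) :
    IsStrongDualityPairing (Ω.tautForm S T) := by
  subst h
  refine ⟨?_, ?_, ?_⟩
  · simp only [tautForm_apply]
    fun_prop
  · refine exists_leftEquiv (Ω.tautForm (Ω.base T) T)
      ((ContinuousLinearMap.precomp ℂ (Ω.fiber T)).comp (innerSLFlip ℂ)) (fun x y => rfl) ?_ ?_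
    · intro x hx
      obtain ⟨y, rfl⟩ := (Ω.bijective_fiber T).2 x
      have h0 := hx y
      rw [tautForm_apply, ← Submodule.coe_inner, inner_self_eq_zero] at h0
      exact h0
    · intro φ
      let ψ : TautFiber H T →L[ℂ] ℂ :=
        ((starL ℂ : ℂ ≃L⋆[ℂ] ℂ) : ℂ →L⋆[ℂ] ℂ).comp φ
      refine ⟨Ω.fiber T ((InnerProductSpace.toDual ℂ _).symm ψ), fun y => ?_⟩
      rw [tautForm_apply, Ω.inner_fiber, ← Submodule.coe_inner, ← inner_conj_symm,
        InnerProductSpace.toDual_symm_apply]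
      simp [ψ]
  · refine ⟨((Ω.fiberEquiv T).toContinuousLinearEquiv).trans
      (InnerProductSpace.toDual ℂ (TautFiber H (Ω.base T))).toContinuousLinearEquiv,
      fun x y => ?_⟩
    rfl

/-- The bundle `Π_{H,Ω}`: the tautological bundle with the involution `S ↦ S^{-*}` of `Gr(H)` and
the like-Hermitian structure associated with `Ω`. -/
def likeHermitian : FibrewiseLikeHermitian (Gr H) (TautFiber H) where
  inv := Ω.base
  inv_inv := Ω.base_base
  form S T _ := Ω.tautForm S T
  strong S T h := Ω.strong_tautForm S T (by rw [← h, Ω.base_base])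
  conj_form S T h h' x y := by
    subst h
    rw [tautForm_apply, tautForm_apply, inner_conj_symm, ← Ω.inner_fiber, Ω.fiber_fiber]

/-- The universal reproducing `(-*)`-kernel `Q_{H,Ω}(S₁, S₂) = p_{S₁} ∘ γ_{S₂} : S₂ → S₁` on
`Π_{H,Ω}`, where `p_S : H → S` is the orthogonal projection. -/
def universalKernel : ReproducingKernel Ω.likeHermitian where
  toFun S₁ S₂ := S₁.toSubmodule.orthogonalProjectionOnto ∘L
    (Ω.base S₂).toSubmodule.subtypeL ∘L Ω.fiber S₂
  pos n t t' h η := by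
    have key : ∀ j l, Ω.likeHermitian.form (t l) (t' l) (h l)
        (((t l).toSubmodule.orthogonalProjectionOnto ∘L
          (Ω.base (t' j)).toSubmodule.subtypeL ∘L Ω.fiber (t' j)) (η j)) (η l) =
        ⟪(Ω.fiber (t' l) (η l) : H), (Ω.fiber (t' j) (η j) : H)⟫_ℂ := by
      intro j l
      have hmem : (Ω.fiber (t' l) (η l) : H) ∈ (t l).toSubmodule := by
        have h' : Ω.base (t' l) = t l := by rw [← h l]; exact Ω.base_base _
        exact h'.le (Ω.fiber (t' l) (η l)).2
      exact Submodule.inner_orthogonalProjectionOnto_eq_of_mem_left ⟨_, hmem⟩ _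
    simp only [key]
    rw [Finset.sum_comm]
    simp only [← inner_sum, ← sum_inner]
    rw [inner_self_eq_norm_sq_to_K]
    positivity

end InvolutiveMorphism

end Grassmannian

end

/-! The morphism is `K̂` itself, with each fibre map `D_s → H^K` regarded as landing in `ζ_K(s)`.
Two things need proof: these maps are bounded, and pulling back the universal kernel returns `K`.

Boundedness: scalar products of vectors `K̂ξ`, `K̂η` are values of the pairing on `K`, which is
jointly continuous, so the squared distance `‖K̂η - K̂ξ‖²` is continuous in `η`.

Pull-back: write `(x | y)` for the scalar product linear in `x`. For `η ∈ D_t`, `ξ ∈ D_w`, the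
definition of the quasi-adjoint turns the pairing of `(Δ^*Q)(w^{-*}, t) η` with `ξ` into `(p γ K̂η |
γ K̂ξ)`, where `p` projects onto `ζ_K(w^{-*})`. By the compatibility of `ζ_K` with the involutions,
`γ K̂ξ` already lies in that subspace, so `p` may be dropped. Since `γ` preserves scalar products
even between different fibres, what remains is `(K̂η | K̂ξ)`, which is the pairing of `K(w^{-*}, t)
η` with `ξ`. Nondegeneracy of the pairing then gives equality of the operators.

The two halves are `continuous_hat` and `eq_pullback_classifyingMorphism`; the latter rests on
`form_universalKernel` and `ext_form`. -/

noncomputable section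

namespace ReproducingKernel

variable {Z : Type u} {D : Z → Type v}
  [∀ z, TopologicalSpace (D z)] [∀ z, AddCommGroup (D z)] [∀ z, Module ℂ (D z)]
  {L : FibrewiseLikeHermitian Z D} (K : ReproducingKernel L)

/-- Both arguments vary with a parameter, so that the square term and the cross term of `‖K̂η -
K̂ξ‖²` are instances of one statement. -/
theorem continuous_inner_hat (s : Z) {X : Type*} [TopologicalSpace X] {f g : X → D s}
    (hf : Continuous f) (hg : Continuous g) :
    Continuous fun x => ⟪K.hat s (f x), K.hat s (g x)⟫_ℂ := by
  simp only [inner_hat]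
  exact (L.strong (L.inv s) s (L.inv_inv s)).continuous.comp
    (((K.toFun (L.inv s) s).continuous.comp hg).prodMk hf)

/-- On each fibre `K̂` is bounded, since `(K(s^{-*}, s) η | ξ)` is jointly continuous. -/
theorem continuous_hat (s : Z) : Continuous (K.hat s) := by
  -- Continuity is checked at every `ξ`, not only at `0`: in this way no continuity of the
  -- translations of `D s` is needed.
  rw [continuous_iff_continuousAt]
  intro ξ
  rw [ContinuousAt, tendsto_iff_norm_sub_tendsto_zero]
  have hc : Continuous fun η => ‖K.hat s η - K.hat s ξ‖ ^ 2 := by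
    -- Expanding the square leaves real parts of scalar products of vectors in the image of `K̂`.
    simp only [@norm_sub_sq ℂ, ← @inner_self_eq_norm_sq ℂ]
    have h₁ := K.continuous_inner_hat s (f := id) (g := id) continuous_id continuous_id
    have h₂ := K.continuous_inner_hat s (f := id) (g := fun _ => ξ) continuous_id continuous_const
    exact ((RCLike.continuous_re.comp h₁).sub
      (continuous_const.mul (RCLike.continuous_re.comp h₂))).add continuous_const
  -- The square root recovers the norm, and the limit at `ξ` is the value there, which is `0`.
  have hs := (Real.continuous_sqrt.comp hc).tendsto ξ
  simpa [Function.comp_def, Real.sqrt_sq] using hs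

theorem hat_mem_zeta (s : Z) (ξ : D s) : K.hat s ξ ∈ (K.zeta s).toSubmodule :=
  Submodule.le_topologicalClosure _ (LinearMap.mem_range_self _ ξ)

/-- `K̂` on the fibre `D_s`, as a bounded operator into `ζ_K(s)`. -/
def hatL (s : Z) : D s →L[ℂ] TautFiber K.RKHS (K.zeta s) :=
  (⟨K.hat s, K.continuous_hat s⟩ : D s →L[ℂ] K.RKHS).codRestrict _ (K.hat_mem_zeta s)

/-- The morphism `Δ_K = (K̂, ζ_K)` into the tautological bundle of `H^K`. -/
def classifyingMorphism (Ω : InvolutiveMorphism K.RKHS)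
    (hΩ : ∀ s, K.zeta (L.inv s) = Ω.base (K.zeta s)) :
    LikeHermitianMorphism L Ω.likeHermitian where
  base := K.zeta
  fiber := K.hatL
  base_inv := hΩ

/-- Operators into a fibre are determined by the pairing with the opposite fibre. -/
theorem ext_form {K₁ K₂ : ReproducingKernel L}
    (h : ∀ (w t : Z) (η : D t) (ξ : D w),
      L.form (L.inv w) w (L.inv_inv w) (K₁.toFun (L.inv w) t η) ξ =
        L.form (L.inv w) w (L.inv_inv w) (K₂.toFun (L.inv w) t η) ξ) : K₁ = K₂ := by
  ext s t η
  -- Every point has the form `w^{-*}`; naming it so avoids a transport between the fibres over `s`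
  -- and `(s^{-*})^{-*}`.
  obtain ⟨w, rfl⟩ : ∃ w, L.inv w = s := ⟨L.inv s, L.inv_inv s⟩
  rw [← sub_eq_zero]
  refine form_left_injective (L := L) (L.inv_inv w) fun ξ => ?_
  rw [map_sub, LinearMap.sub_apply, h, sub_self]

end ReproducingKernel

/-- The pairing contributes a `γ` on `y` and the kernel a `γ` on `x`; they cancel because `γ`
preserves scalar products across different fibres. -/
theorem InvolutiveMorphism.form_universalKernel {H : Type u} [NormedAddCommGroup H]
    [InnerProductSpace ℂ H] [CompleteSpace H] (Ω : InvolutiveMorphism H) {S S' T : Gr H}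
    (h : Ω.base S = S') (x : TautFiber H T) (y : TautFiber H S') :
    Ω.likeHermitian.form S S' h (Ω.universalKernel.toFun S T x) y = ⟪(y : H), (x : H)⟫_ℂ := by
  -- This membership makes the projection onto `S` invisible to the scalar product with `γ y`.
  have hmem : (Ω.fiber S' y : H) ∈ S.toSubmodule := by
    have h' : Ω.base S' = S := by rw [← h, Ω.base_base]
    exact h'.le (Ω.fiber S' y).2
  exact (Submodule.inner_orthogonalProjectionOnto_eq_of_mem_left ⟨_, hmem⟩ _).trans
    (Ω.inner_fiber S' T y x)

theorem ReproducingKernel.eq_pullback_classifyingMorphism {Z : Type u} {D : Z → Type v}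
    [∀ z, TopologicalSpace (D z)] [∀ z, AddCommGroup (D z)] [∀ z, Module ℂ (D z)]
    {L : FibrewiseLikeHermitian Z D} (K : ReproducingKernel L) (Ω : InvolutiveMorphism K.RKHS)
    (hΩ : ∀ s, K.zeta (L.inv s) = Ω.base (K.zeta s)) :
    K = (K.classifyingMorphism Ω hΩ).pullback Ω.universalKernel := by
  refine ext_form fun w t η ξ => ?_
  -- `hΩ` at the point `w^{-*}`: the fibres over `ζ_K(w^{-*})` and `ζ_K(w)` are in duality.
  have h' : Ω.likeHermitian.inv (K.zeta (L.inv w)) = K.zeta w :=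
    (hΩ _).symm.trans (by rw [L.inv_inv])
  rw [← K.inner_hat]
  -- The intermediate term is the pairing of `Q(ζ_K(w^{-*}), ζ_K(t)) K̂η` with `K̂ξ` in the
  -- tautological bundle.
  refine Eq.trans ?_
    ((K.classifyingMorphism Ω hΩ).form_quasiAdjoint' (L.inv_inv w) h' _ ξ)
  exact (Ω.form_universalKernel h' (K.hatL t η) (K.hatL w ξ)).symm

end

theorem theorem5p1
    {E : Type*} [NormedAddCommGroup E] [NormedSpace ℝ E] [CompleteSpace E]
    {F : Type*} [NormedAddCommGroup F] [NormedSpace ℂ F] [CompleteSpace F]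
    {Z : Type*} [TopologicalSpace Z] [ChartedSpace E Z] [IsManifold 𝓘(ℝ, E) ∞ Z]
    {D : Z → Type*} [TopologicalSpace (TotalSpace F D)]
    [∀ z, TopologicalSpace (D z)] [∀ z, AddCommGroup (D z)] [∀ z, Module ℂ (D z)]
    [FiberBundle F D] [VectorBundle ℂ F D] [VectorBundle ℝ F D]
    [ContMDiffVectorBundle ∞ F D 𝓘(ℝ, E)]
    (L : LikeHermitianStructure E F D)
    (K : ReproducingKernel L.toFibrewiseLikeHermitian)
    (Ω : InvolutiveMorphism K.RKHS)
    (hΩ : ∀ s : Z, K.zeta (L.inv s) = Ω.base (K.zeta s)) :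
    ∃ Δ : LikeHermitianMorphism L.toFibrewiseLikeHermitian Ω.likeHermitian,
      Δ.base = K.zeta ∧ K = Δ.pullback Ω.universalKernel :=
  ⟨K.classifyingMorphism Ω hΩ, rfl, K.eq_pullback_classifyingMorphism Ω hΩ⟩
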